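/- Consider the exclusion process on $\mathbb Z$ with a driven tagged particle: red particles jump from $x$ to a vacant site $y$ at rate $p(y-x)$, the tagged particle jumps from its position $X$ to a vacant site $X+z$ at rate $q(z)$, and every site holds at most one particle. Assume $p,q\ge 0$, $p(2)=p(-2)>0$, $p(1)>p(-1)\ge p(-2)$, $p(k)=0$ for $|k|>2$, and $q(k)=0$ for $|k|>1$. Let $\xi_t\in\{0,1\}^{\mathbb Z\setminus\{0\}}$ be the environment seen from the tagged particle, $D_t$ the displacement of the tagged particle up to time $t$, and $N_t$ the net number of red particles that have jumped from the left to the right of the tagged particle up to time $t$. Let $\nu_0$ be any probability measure on $\{0,1\}^{\mathbb Z\setminus\{0\}}$, let $\mathbb E^{\nu_0,q}$ be the expectation for the process with $\xi_0\sim\nu_0$, $N_0=D_0=0$, and let $\nu_T$ be defined by $\langle\nu_T,f\rangle=\frac1T\mathbb E^{\nu_0,q}\big[\int_0^T f(\xi_s)\,ds\big]$. Then $D_t$ and $N_t$ are integrable for all $t$, and there are a sequence $0<T_n\uparrow\infty$ and a probability measure $\bar\nu$ such that $\nu_{T_n}\to\bar\nu$ weakly, $\bar\nu$ is invariant for the environment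 process, and $$\liminf_{t\to\infty}\mathbb E^{\nu_0,q}\Big[\frac{D_t}{t}\Big]=q(1)\langle\bar\nu,1-\xi_1\rangle-q(-1)\langle\bar\nu,1-\xi_{-1}\rangle .$$ Furthermore, if $\liminf_{t\to\infty}\mathbb E^{\nu_0,q}[N_t/t]\ge C_0$ for some $C_0>0$, then $$\liminf_{t\to\infty}\mathbb E^{\nu_0,q}\Big[\frac{D_t}{t}\Big]\ \ge\ \frac{q(1)}{p(2)}\,C_0-\max\{q(-1)-q(1),\,0\},$$ that is, $\ge \frac{q(1)}{p(2)}C_0-(q(-1)-q(1))$ whenever $q(-1)\ge q(1)$. -/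

import Mathlib

open MeasureTheory ProbabilityTheory Filter Topology
open scoped NNReal

namespace TaggedExclusion

/-- Sites relative to the tagged particle: `ℤ \ {0}`. -/
abbrev Site : Type := {x : ℤ // x ≠ 0}

/-- Configurations seen from the tagged particle, `{0,1}^{ℤ \ {0}}`, with the product topology and
the product `σ`-algebra; `true` means occupied. -/
abbrev Env : Type := Site → Bool

/-- The site `1`. -/
def siteOne : Site := ⟨1, by norm_num⟩

/-- The site `-1`. -/
def siteNegOne : Site := ⟨-1, by norm_num⟩

/-- The occupation number `ξ_x ∈ {0, 1}`. -/
def occ (ξ : Env) (x : Site) : ℝ := if ξ x = true then 1 else 0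

/-- The configuration `ξ^{x,y}`: the contents of `x` and `y` are exchanged. -/
def exchange (x y : Site) (ξ : Env) : Env := fun z =>
  if z = x then ξ y else if z = y then ξ x else ξ z

/-- The configuration `θ_z ξ` seen by the tagged particle after its jump to `z`. -/
def shift (z : Site) (ξ : Env) : Env := fun x =>
  if h : (x : ℤ) + z = 0 then ξ z else ξ ⟨x + z, h⟩

/-- Net number of passages from the left to the right of the tagged particle in a jump of a red
particle from `x` to `y`. -/
def crossing (x y : Site) : ℤ :=
  if (x : ℤ) < 0 ∧ 0 < (y : ℤ) then 1 else if 0 < (x : ℤ) ∧ (y : ℤ) < 0 then -1 else 0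

/-- The state `(ξ, N, D)` of the joint process: the environment, the net number of red particles
that have jumped from the left to the right of the tagged particle, and the displacement of the
tagged particle. -/
abbrev State : Type := Env × ℤ × ℤ

/-- The generator of the joint process `(ξ_t, N_t, D_t)`. A red particle jumps from `x` to a vacant
`y` at rate `p (y - x)`, which changes `N` by `crossing x y`; the tagged particle jumps to a
vacant `z` at rate `q z`, which changes `D` by `z`. On functions of `ξ` alone this is the generator
of the environment process. For bounded local functions and finite-range rates both
sums have finitely many nonzero terms. -/
noncomputable def generator (p q : ℤ → ℝ) (F : State → ℝ) (s : State) : ℝ :=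
  (∑' e : Site × Site, p (e.2 - e.1) * occ s.1 e.1 * (1 - occ s.1 e.2) *
      (F (exchange e.1 e.2 s.1, s.2.1 + crossing e.1 e.2, s.2.2) - F s)) +
    ∑' z : Site, q z * (1 - occ s.1 z) * (F (shift z s.1, s.2.1, s.2.2 + z) - F s)

/-- Bounded functions of `(ξ, n, d)` that depend on finitely many coordinates of `ξ`. -/
def IsBoundedLocal (F : State → ℝ) : Prop :=
  (∃ C : ℝ, ∀ s, |F s| ≤ C) ∧
    ∃ A : Finset Site, ∀ ξ ξ' : Env, (∀ x ∈ A, ξ x = ξ' x) → ∀ n d : ℤ, F (ξ, n, d) = F (ξ', n, d)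

/-- Right-continuous paths with left limits. -/
def IsCadlag (w : ℝ≥0 → State) : Prop :=
  ∀ t, ContinuousWithinAt w (Set.Ici t) t ∧ ∃ l, Tendsto w (𝓝[<] t) (𝓝 l)

/-- The space of càdlàg paths, with the `σ`-algebra generated by the coordinates. -/
abbrev Path : Type := {w : ℝ≥0 → State // IsCadlag w}

/-- The environment `ξ_t` seen from the tagged particle. -/
def env (t : ℝ≥0) (w : Path) : Env := (w.1 t).1

/-- The integrated current `N_t`. -/
def current (t : ℝ≥0) (w : Path) : ℝ := ((w.1 t).2.1 : ℝ)

/-- The displacement `D_t` of the tagged particle. -/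
def displacement (t : ℝ≥0) (w : Path) : ℝ := ((w.1 t).2.2 : ℝ)

/-- The filtration generated by the coordinates. -/
def pathFiltration : Filtration ℝ≥0 (inferInstance : MeasurableSpace Path) where
  seq t := ⨆ s : ℝ≥0, ⨆ _ : s ≤ t, MeasurableSpace.comap (fun w : Path => w.1 s) inferInstance
  mono' _ _ h := iSup₂_le fun s hs => le_iSup₂_of_le s (hs.trans h) le_rfl
  le' _ := iSup₂_le fun s _ =>
    Measurable.comap_le ((measurable_pi_apply s).comp measurable_subtype_coe)

/-- `P η` is, for every configuration `η`, the law on càdlàg paths of the exclusion process with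
a driven tagged particle, with rates `p` and `q`, started from `ξ_0 = η`, `N_0 = 0`, `D_0 = 0`:
it solves the martingale problem for the generator. -/
structure IsProcessLaw (p q : ℤ → ℝ) (P : Kernel Env Path) : Prop where
  isMarkov : IsMarkovKernel P
  initial : ∀ η, ∀ᵐ w ∂(P η), w.1 0 = (η, 0, 0)
  martingale : ∀ F : State → ℝ, IsBoundedLocal F → ∀ η,
    Martingale (fun (t : ℝ≥0) (w : Path) =>
      F (w.1 t) - ∫ s in (0 : ℝ)..t, generator p q F (w.1 s.toNNReal)) pathFiltration (P η)

/-- The law `∫ P^η dν₀(η)` of the process with initial distribution `ν₀`. -/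
noncomputable def pathLaw (P : Kernel Env Path) (ν₀ : ProbabilityMeasure Env) : Measure Path :=
  (ν₀ : Measure Env).bind P

/-- `⟨ν_t, f⟩ = (1/t) E^{ν₀} [∫_0^t f(ξ_s) ds]`. -/
noncomputable def timeAverage (P : Kernel Env Path) (ν₀ : ProbabilityMeasure Env) (t : ℝ)
    (f : Env → ℝ) : ℝ :=
  t⁻¹ * ∫ w, (∫ s in (0 : ℝ)..t, f (env s.toNNReal w)) ∂(pathLaw P ν₀)

/-- `ν` is invariant for the environment process: started from `ν`, the law of `ξ_t` is `ν` for
every `t ≥ 0`. -/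
def IsInvariant (P : Kernel Env Path) (ν : ProbabilityMeasure Env) : Prop :=
  ∀ t : ℝ≥0, (pathLaw P ν).map (env t) = (ν : Measure Env)

/-- The lower limit, as `t → ∞`, of `E^{ν₀} [X_t / t]`, in the extended reals. -/
noncomputable def liminfMean (P : Kernel Env Path) (ν₀ : ProbabilityMeasure Env)
    (X : ℝ≥0 → Path → ℝ) : EReal :=
  liminf (fun t : ℝ≥0 => ((∫ w, X t w / t ∂(pathLaw P ν₀) : ℝ) : EReal)) atTop

/-- Jump rates. -/
def IsRate (r : ℤ → ℝ) : Prop := ∀ k, 0 ≤ r k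

/-- The positivity assumption on the rates of the red particles. -/
def IsPositive (p : ℤ → ℝ) : Prop := p 2 = p (-2) ∧ 0 < p (-2) ∧ p (-1) < p 1

/-- The attractiveness assumption on the rates of the red particles. -/
def IsAttractive (p : ℤ → ℝ) : Prop := p (-2) ≤ p (-1) ∧ ∀ k : ℤ, 2 < |k| → p k = 0

/-- Nearest-neighbour rates. -/
def IsNearestNeighbor (q : ℤ → ℝ) : Prop := ∀ k : ℤ, 1 < |k| → q k = 0

end TaggedExclusion

namespace TaggedExclusion

/-! ### Joint measurability of càdlàg paths -/

/-! The mean displacement and the mean current are time integrals of means of local functions of the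
environment: the drift of the tagged particle and, since `p 2 = p (-2)` cancels the quadratic terms,
`p 2 * (ξ_{-1} - ξ_1)` (`IsCounter.mean_eq`). Hence `E[D_t / t]` and `E[N_t / t]` are time averages.
Choose times along which the first tends to its lower limit; as the space of probability measures on
the compact space `Env` is compact, the time-average measures converge along a subsequence to some
`ν`, and the drift, being continuous, passes to the limit (`exists_seq_tendsto_timeAverage`).

Dynkin's formula makes the time average of `L f` of order `1 / T`, so `ν` annihilates `L f` for
local `f`. Invariance is then deduced from the martingale problem alone: iterating Dynkin's formula
`n` times bounds `|E^ν f(ξ_t) - ⟨ν, f⟩|` by `t ^ n / n!` times a bound on `L^n f`. Each application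
of `L` enlarges the box by `2` and costs a factor linear in its size, so the bound on `L^n f` grows
like `C ^ n * n!`. The error vanishes for small `t`, uniformly enough to reach every time by finite
steps (`abs_mean_sub_le`, `AgreesAt.add`).

Along the same times the current hypothesis gives `p 2 * (v₁ - v₂) ≥ C₀`, where `v₁`, `v₂` are the
`ν`-probabilities that `1`, `-1` are vacant. The speed bound follows from `q 1 * v₁ - q (-1) * v₂ =
q 1 * (v₁ - v₂) - (q (-1) - q 1) * v₂` and `0 ≤ v₂ ≤ 1`. -/

lemma measurable_eval (t : ℝ≥0) : Measurable fun w : Path => w.1 t :=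
  (measurable_pi_apply t).comp measurable_subtype_coe

/-- The smallest point of the grid `(n + 1)⁻¹ ℕ` strictly above `s`. -/
noncomputable def gridAbove (n : ℕ) (s : ℝ≥0) : ℝ≥0 :=
  ((⌊((n : ℝ≥0) + 1) * s⌋₊ : ℝ≥0) + 1) / ((n : ℝ≥0) + 1)

lemma le_gridAbove (n : ℕ) (s : ℝ≥0) : s ≤ gridAbove n s := by
  unfold gridAbove
  rw [le_div_iff₀ (by positivity), mul_comm]
  exact (Nat.lt_floor_add_one _).le

lemma gridAbove_le (n : ℕ) (s : ℝ≥0) : gridAbove n s ≤ s + 1 / ((n : ℝ≥0) + 1) := by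
  unfold gridAbove
  rw [add_div]
  gcongr
  rw [div_le_iff₀ (by positivity), mul_comm s]
  exact Nat.floor_le (by positivity)

lemma tendsto_gridAbove (s : ℝ≥0) : Tendsto (fun n => gridAbove n s) atTop (𝓝[Set.Ici s] s) := by
  refine tendsto_nhdsWithin_iff.2 ⟨?_, Eventually.of_forall fun n => le_gridAbove n s⟩
  refine tendsto_of_tendsto_of_tendsto_of_le_of_le tendsto_const_nhds ?_
    (fun n => le_gridAbove n s) (fun n => gridAbove_le n s)
  have h : Tendsto (fun n : ℕ => 1 / ((n : ℝ≥0) + 1)) atTop (𝓝 0) :=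
    tendsto_one_div_add_atTop_nhds_zero_nat
  simpa using h.const_add s

/-- By right-continuity the path at `s` is the limit of its values at grid points above `s`. These
are jointly measurable because the grid is countable. -/
lemma measurable_eval_uncurry : Measurable fun x : ℝ≥0 × Path => x.2.1 x.1 := by
  refine measurable_of_tendsto_metrizable (f := fun (n : ℕ) (x : ℝ≥0 × Path) =>
    x.2.1 (gridAbove n x.1)) (fun n => ?_) ?_
  · have h1 : Measurable fun y : ℕ × Path => y.2.1 (((y.1 : ℝ≥0) + 1) / ((n : ℝ≥0) + 1)) :=
      measurable_from_prod_countable_right fun k =>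
        measurable_eval (((k : ℝ≥0) + 1) / ((n : ℝ≥0) + 1))
    have h2 : Measurable fun x : ℝ≥0 × Path => (⌊((n : ℝ≥0) + 1) * x.1⌋₊, x.2) := by
      refine Measurable.prodMk (Nat.measurable_floor.comp ?_) measurable_snd
      exact measurable_fst.const_mul _
    exact h1.comp h2
  · rw [tendsto_pi_nhds]
    rintro ⟨s, w⟩
    exact (w.2 s).1.tendsto.comp (tendsto_gridAbove s)

lemma measurable_uncurry_real {G : State → ℝ} (hG : Measurable G) :
    Measurable fun x : Path × ℝ => G (x.1.1 x.2.toNNReal) := by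
  have h : Measurable fun x : Path × ℝ => (x.2.toNNReal, x.1) :=
    (measurable_real_toNNReal.comp measurable_snd).prodMk measurable_fst
  exact hG.comp (measurable_eval_uncurry.comp h)

/-! ### Expectations under the path law -/

variable {P : Kernel Env Path} (ν : ProbabilityMeasure Env)

lemma isProbabilityMeasure_pathLaw [IsMarkovKernel P] : IsProbabilityMeasure (pathLaw P ν) := by
  unfold pathLaw
  infer_instance

lemma integral_pathLaw [IsMarkovKernel P] {f : Path → ℝ} (hf : Integrable f (pathLaw P ν)) :
    ∫ w, f w ∂(pathLaw P ν) = ∫ η, ∫ w, f w ∂(P η) ∂(ν : Measure Env) := by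
  unfold pathLaw at *
  rw [Measure.comp_eq_comp_const_apply] at *
  rw [Kernel.integral_comp hf, Kernel.const_apply]

lemma integrable_of_bounded {α : Type*} [MeasurableSpace α] {μ : Measure α} [IsFiniteMeasure μ]
    {f : α → ℝ} (hf : Measurable f) {C : ℝ} (hC : ∀ x, |f x| ≤ C) : Integrable f μ :=
  Integrable.of_bound hf.aestronglyMeasurable C (Eventually.of_forall hC)

lemma integrable_eval [IsMarkovKernel P] {G : State → ℝ} (hG : Measurable G) {C : ℝ}
    (hC : ∀ s, |G s| ≤ C) (t : ℝ≥0) : Integrable (fun w : Path => G (w.1 t)) (pathLaw P ν) := by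
  have := isProbabilityMeasure_pathLaw (P := P) ν
  exact integrable_of_bounded (hG.comp (measurable_eval t)) fun w => hC _

/-- The expectation of `G (ξ_t, N_t, D_t)`. -/
noncomputable def mean (P : Kernel Env Path) (ν : ProbabilityMeasure Env) (G : State → ℝ)
    (t : ℝ) : ℝ := ∫ w : Path, G (w.1 t.toNNReal) ∂(pathLaw P ν)

lemma integrable_uncurry [IsMarkovKernel P] {G : State → ℝ} (hG : Measurable G) {C : ℝ}
    (hC : ∀ s, |G s| ≤ C) (a b : ℝ) :
    Integrable (fun x : Path × ℝ => G (x.1.1 x.2.toNNReal))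
      ((pathLaw P ν).prod (volume.restrict (Set.Ioc a b))) := by
  have := isProbabilityMeasure_pathLaw (P := P) ν
  exact integrable_of_bounded (measurable_uncurry_real hG) fun w => hC _

lemma intervalIntegrable_mean [IsMarkovKernel P] {G : State → ℝ} (hG : Measurable G) {C : ℝ}
    (hC : ∀ s, |G s| ≤ C) {a b : ℝ} (hab : a ≤ b) :
    IntervalIntegrable (mean P ν G) volume a b := by
  have := isProbabilityMeasure_pathLaw (P := P) ν
  rw [intervalIntegrable_iff_integrableOn_Ioc_of_le hab]
  exact (integrable_uncurry ν hG hC a b).integral_prod_right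

lemma integral_pathLaw_intervalIntegral [IsMarkovKernel P] {G : State → ℝ} (hG : Measurable G)
    {C : ℝ} (hC : ∀ s, |G s| ≤ C) {t : ℝ} (ht : 0 ≤ t) :
    ∫ w : Path, (∫ s in (0 : ℝ)..t, G (w.1 s.toNNReal)) ∂(pathLaw P ν) =
      ∫ s in (0 : ℝ)..t, mean P ν G s := by
  have := isProbabilityMeasure_pathLaw (P := P) ν
  simp_rw [intervalIntegral.integral_of_le ht]
  exact integral_integral_swap (integrable_uncurry ν hG hC 0 t)

lemma integrable_intervalIntegral [IsMarkovKernel P] {G : State → ℝ} (hG : Measurable G)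
    {C : ℝ} (hC : ∀ s, |G s| ≤ C) {t : ℝ} (ht : 0 ≤ t) :
    Integrable (fun w : Path => ∫ s in (0 : ℝ)..t, G (w.1 s.toNNReal)) (pathLaw P ν) := by
  have := isProbabilityMeasure_pathLaw (P := P) ν
  simp_rw [intervalIntegral.integral_of_le ht]
  exact (integrable_uncurry ν hG hC 0 t).integral_prod_left

lemma abs_mean_le [IsMarkovKernel P] {G : State → ℝ} {C : ℝ} (hC : ∀ s, |G s| ≤ C) (t : ℝ) :
    |mean P ν G t| ≤ C := by
  have := isProbabilityMeasure_pathLaw (P := P) ν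
  simpa [mean] using norm_integral_le_of_norm_le_const (μ := pathLaw P ν)
    (f := fun w : Path => G (w.1 t.toNNReal)) (Eventually.of_forall fun w => hC _)

/-! ### The Dynkin formula -/

/-- Such a function factors through the restriction to `A`, which takes values in a discrete space.
-/
lemma continuous_of_local {F : State → ℝ} {A : Finset Site}
    (hA : ∀ ξ ξ' : Env, (∀ x ∈ A, ξ x = ξ' x) → ∀ n d : ℤ, F (ξ, n, d) = F (ξ', n, d)) :
    Continuous F := by
  classical
  let r : State → (A → Bool) × ℤ × ℤ := fun s => (fun x => s.1 x, s.2)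
  let e : (A → Bool) × ℤ × ℤ → State := fun y =>
    (fun x => if h : x ∈ A then y.1 ⟨x, h⟩ else false, y.2)
  have hr : Continuous r := by fun_prop
  have hFr : F = (F ∘ e) ∘ r := by
    funext ⟨ξ, n, d⟩
    refine hA _ _ (fun x hx => ?_) n d
    simp [r, hx]
  rw [hFr]
  exact continuous_of_discreteTopology.comp hr

lemma IsBoundedLocal.measurable {F : State → ℝ} (hF : IsBoundedLocal F) : Measurable F := by
  obtain ⟨-, A, hA⟩ := hF
  exact (continuous_of_local hA).measurable

lemma integral_start [IsMarkovKernel P] {F : State → ℝ} {η : Env}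
    (hη : ∀ᵐ w ∂(P η), w.1 0 = (η, 0, 0)) : ∫ w, F (w.1 0) ∂(P η) = F (η, 0, 0) := by
  rw [integral_congr_ae (g := fun _ => F (η, 0, 0)) (hη.mono fun w hw => by simp [hw])]
  simp

variable {p q : ℤ → ℝ}

lemma IsProcessLaw.mean_zero (hP : IsProcessLaw p q P) {F : State → ℝ} (hF : Measurable F)
    {C : ℝ} (hC : ∀ s, |F s| ≤ C) :
    mean P ν F 0 = ∫ η, F (η, 0, 0) ∂(ν : Measure Env) := by
  have := hP.isMarkov
  unfold mean
  rw [integral_pathLaw ν (integrable_eval ν hF hC _)]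
  simp only [Real.toNNReal_zero, integral_start (hP.initial _)]

lemma IsProcessLaw.dynkin (hP : IsProcessLaw p q P) {F : State → ℝ} (hF : IsBoundedLocal F)
    (hG : Measurable (generator p q F)) {C : ℝ} (hC : ∀ s, |generator p q F s| ≤ C) {t : ℝ}
    (ht : 0 ≤ t) :
    mean P ν F t = mean P ν F 0 + ∫ s in (0 : ℝ)..t, mean P ν (generator p q F) s := by
  have := hP.isMarkov
  obtain ⟨CF, hCF⟩ := hF.1
  have key : ∀ η, ∫ w, (F (w.1 t.toNNReal) -
      ∫ s in (0 : ℝ)..t, generator p q F (w.1 s.toNNReal)) ∂(P η) = F (η, 0, 0) := by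
    intro η
    -- A martingale has constant expectation; compare times `0` and `t` on the whole space.
    have h := (hP.martingale F hF η).setIntegral_eq (zero_le (a := t.toNNReal)) (s := Set.univ)
      MeasurableSet.univ
    simp only [Measure.restrict_univ, NNReal.coe_zero, intervalIntegral.integral_same,
      sub_zero, Real.coe_toNNReal t ht, integral_start (hP.initial η)] at h
    exact h.symm
  have i1 := integrable_eval (P := P) ν hF.measurable hCF t.toNNReal
  have i2 := integrable_intervalIntegral (P := P) ν hG hC ht
  have h := integral_pathLaw ν (i1.sub i2)
  simp only [Pi.sub_apply, key] at h
  rw [integral_sub i1 i2, integral_pathLaw_intervalIntegral ν hG hC ht,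
    ← hP.mean_zero ν hF.measurable hCF] at h
  unfold mean at *
  linarith

/-! ### The generator on local functions of the environment -/

/-- The sites at distance at most `a` from the tagged particle. -/
noncomputable def box (a : ℕ) : Finset Site := (Finset.Icc (-(a : ℤ)) a).subtype (· ≠ 0)

lemma mem_box {a : ℕ} {x : Site} : x ∈ box a ↔ -(a : ℤ) ≤ x ∧ (x : ℤ) ≤ a := by
  simp [box, Finset.mem_subtype]

/-- The function `f` depends only on the sites at distance at most `a`. -/
def DependsOnBox (a : ℕ) (f : Env → ℝ) : Prop :=
  ∀ ξ ξ' : Env, (∀ x ∈ box a, ξ x = ξ' x) → f ξ = f ξ'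

/-- A function of the environment as a function of the state. -/
def lift (f : Env → ℝ) (s : State) : ℝ := f s.1

/-- The generator of the environment process. -/
noncomputable def envGenerator (p q : ℤ → ℝ) (f : Env → ℝ) (ξ : Env) : ℝ :=
  generator p q (lift f) (ξ, 0, 0)

lemma DependsOnBox.isBoundedLocal {a : ℕ} {f : Env → ℝ} (hf : DependsOnBox a f) {C : ℝ}
    (hC : ∀ ξ, |f ξ| ≤ C) : IsBoundedLocal (lift f) :=
  ⟨⟨C, fun s => hC s.1⟩, box a, fun ξ ξ' h _ _ => hf ξ ξ' h⟩

/-- The edges along which a jump of range at most `2` can change the configuration in `box a`. -/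
noncomputable def edges (a : ℕ) : Finset (Site × Site) :=
  (box (a + 2) ×ˢ box (a + 2)).filter fun e => |(e.2 : ℤ) - e.1| ≤ 2

/-- An edge is determined by its starting point (at most `2 * a + 5` choices) and its increment (`5`
choices). -/
lemma card_edges_le (a : ℕ) : ((edges a).card : ℝ) ≤ 5 * (2 * a + 5) := by
  have h : (edges a).card ≤
      (Finset.Icc (-((a + 2 : ℕ) : ℤ)) ((a + 2 : ℕ) : ℤ) ×ˢ Finset.Icc (-2 : ℤ) 2).card := by
    refine Finset.card_le_card_of_injOn (fun e => ((e.1 : ℤ), (e.2 : ℤ) - e.1)) ?_ ?_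
    · intro e he
      simp only [edges, Finset.coe_filter, Set.mem_ofPred_eq, Finset.mem_product, mem_box,
        abs_le] at he
      simp only [Finset.coe_product, Finset.coe_Icc, Set.mem_prod, Set.mem_Icc]
      exact ⟨he.1.1, he.2⟩
    · rintro ⟨x, y⟩ - ⟨x', y'⟩ - h
      simp only [Prod.mk.injEq] at h
      have h1 : x = x' := Subtype.ext h.1
      have h2 : y = y' := Subtype.ext (by linarith [h.1, h.2])
      rw [h1, h2]
  have h' : (Finset.Icc (-((a + 2 : ℕ) : ℤ)) ((a + 2 : ℕ) : ℤ) ×ˢ Finset.Icc (-2 : ℤ) 2).card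
      = 5 * (2 * a + 5) := by
    rw [Finset.card_product, Int.card_Icc, Int.card_Icc]
    push_cast
    omega
  rw [h'] at h
  exact_mod_cast h

lemma tsum_site_eq {q : ℤ → ℝ} (hnn : IsNearestNeighbor q) (F : Site → ℝ) :
    ∑' z : Site, q z * F z = q 1 * F siteOne + q (-1) * F siteNegOne := by
  have hne : siteOne ≠ siteNegOne := by
    intro h
    exact absurd (congrArg Subtype.val h) (by norm_num [siteOne, siteNegOne])
  rw [tsum_eq_sum (s := {siteOne, siteNegOne}), Finset.sum_pair hne]
  · rfl
  · intro z hz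
    simp only [Finset.mem_insert, Finset.mem_singleton, not_or] at hz
    have h0 := z.2
    have h1 : (z : ℤ) ≠ 1 := fun h => hz.1 (Subtype.ext h)
    have h2 : (z : ℤ) ≠ -1 := fun h => hz.2 (Subtype.ext h)
    rw [hnn z (by rw [lt_abs]; omega), zero_mul]

lemma occ_nonneg (ξ : Env) (x : Site) : 0 ≤ occ ξ x := by
  unfold occ; split_ifs <;> norm_num

lemma occ_le_one (ξ : Env) (x : Site) : occ ξ x ≤ 1 := by
  unfold occ; split_ifs <;> norm_num

section
variable {p q : ℤ → ℝ} {a : ℕ} {f : Env → ℝ}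

lemma DependsOnBox.envGenerator_eq (hf : DependsOnBox a f) (hattr : IsAttractive p)
    (hnn : IsNearestNeighbor q) (ξ : Env) :
    envGenerator p q f ξ =
      (∑ e ∈ edges a, p (e.2 - e.1) * occ ξ e.1 * (1 - occ ξ e.2) *
        (f (exchange e.1 e.2 ξ) - f ξ)) +
      (q 1 * ((1 - occ ξ siteOne) * (f (shift siteOne ξ) - f ξ)) +
        q (-1) * ((1 - occ ξ siteNegOne) * (f (shift siteNegOne ξ) - f ξ))) := by
  unfold envGenerator generator lift
  congr 1
  · refine tsum_eq_sum fun e he => ?_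
    simp only [edges, Finset.mem_filter, Finset.mem_product, mem_box, not_and, not_le] at he
    by_cases h2 : 2 < |(e.2 : ℤ) - e.1|
    · rw [hattr.2 _ h2]; ring
    -- An edge of length at most `2` that leaves `box (a + 2)` has no endpoint in `box a`.
    · have : f (exchange e.1 e.2 ξ) = f ξ := by
        refine hf _ _ fun x hx => ?_
        rw [mem_box] at hx
        rw [not_lt, abs_le] at h2
        have hb : ¬ ((-((a + 2 : ℕ) : ℤ) ≤ e.1 ∧ (e.1 : ℤ) ≤ ((a + 2 : ℕ) : ℤ)) ∧
            (-((a + 2 : ℕ) : ℤ) ≤ e.2 ∧ (e.2 : ℤ) ≤ ((a + 2 : ℕ) : ℤ))) := by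
          intro h
          have := he h
          rw [lt_abs] at this
          omega
        push_cast at hb
        have h1 : x ≠ e.1 := fun h => by rw [h] at hx; omega
        have h3 : x ≠ e.2 := fun h => by rw [h] at hx; omega
        simp [exchange, h1, h3]
      simp [this]
  · simp_rw [mul_assoc]
    exact tsum_site_eq hnn fun z => (1 - occ ξ z) * (f (shift z ξ) - f ξ)

lemma shift_congr {z : Site} (hz : |(z : ℤ)| ≤ 1) {ξ ξ' : Env}
    (h : ∀ x ∈ box (a + 2), ξ x = ξ' x) : ∀ x ∈ box a, shift z ξ x = shift z ξ' x := by
  intro x hx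
  rw [mem_box] at hx
  rw [abs_le] at hz
  unfold shift
  split_ifs
  · exact h z (mem_box.2 (by push_cast; omega))
  · exact h _ (mem_box.2 (by push_cast; omega))

lemma exchange_congr {e : Site × Site} (he : e ∈ edges a) {ξ ξ' : Env}
    (h : ∀ x ∈ box (a + 2), ξ x = ξ' x) :
    ∀ x ∈ box a, exchange e.1 e.2 ξ x = exchange e.1 e.2 ξ' x := by
  intro x hx
  simp only [edges, Finset.mem_filter, Finset.mem_product] at he
  unfold exchange
  split_ifs
  · exact h _ he.1.2
  · exact h _ he.1.1
  · rw [mem_box] at hx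
    exact h _ (mem_box.2 (by push_cast; omega))

lemma occ_congr {ξ ξ' : Env} {x : Site} (h : ξ x = ξ' x) : occ ξ x = occ ξ' x := by
  simp [occ, h]

lemma DependsOnBox.mono {b : ℕ} (hf : DependsOnBox a f) (hab : a ≤ b) : DependsOnBox b f :=
  fun _ _ h => hf _ _ fun x hx => h x (by rw [mem_box] at *; omega)

lemma DependsOnBox.dependsOnBox_envGenerator (hf : DependsOnBox a f) (hattr : IsAttractive p)
    (hnn : IsNearestNeighbor q) : DependsOnBox (a + 2) (envGenerator p q f) := by
  intro ξ ξ' h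
  rw [hf.envGenerator_eq hattr hnn, hf.envGenerator_eq hattr hnn]
  have h1 : occ ξ siteOne = occ ξ' siteOne :=
    occ_congr (h _ (mem_box.2 (by simp only [siteOne]; push_cast; omega)))
  have h2 : occ ξ siteNegOne = occ ξ' siteNegOne :=
    occ_congr (h _ (mem_box.2 (by simp only [siteNegOne]; push_cast; omega)))
  rw [h1, h2, hf _ _ (shift_congr (z := siteOne) (by simp [siteOne]) h),
    hf _ _ (shift_congr (z := siteNegOne) (by simp [siteNegOne]) h),
    (hf.mono (Nat.le_add_right a 2)) _ _ h]
  congr 1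
  refine Finset.sum_congr rfl fun e he => ?_
  rw [hf _ _ (exchange_congr he h)]
  simp only [edges, Finset.mem_filter, Finset.mem_product] at he
  rw [occ_congr (h _ he.1.1), occ_congr (h _ he.1.2)]

/-- The growth rate of the generator on local functions. -/
noncomputable def growthRate (p q : ℤ → ℝ) : ℝ :=
  50 * (∑ k ∈ Finset.Icc (-2 : ℤ) 2, p k) + 2 * (q 1 + q (-1)) + 1

lemma growthRate_pos (hp : IsRate p) (hq : IsRate q) : 0 < growthRate p q := by
  have h := Finset.sum_nonneg fun k (_ : k ∈ Finset.Icc (-2 : ℤ) 2) => hp k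
  have h1 := hq 1
  have h2 := hq (-1)
  unfold growthRate
  linarith

lemma abs_mul_vacancy_le {r : ℝ} (hr : 0 ≤ r) (ξ : Env) (x : Site) :
    |r * (1 - occ ξ x)| ≤ r := by
  have h : |1 - occ ξ x| ≤ 1 := by
    rw [abs_le]; constructor <;> linarith [occ_nonneg ξ x, occ_le_one ξ x]
  rw [abs_mul, abs_of_nonneg hr]
  exact mul_le_of_le_one_right hr h

lemma abs_jump_le {r u v B : ℝ} (hr : 0 ≤ r) (hu : |u| ≤ B) (hv : |v| ≤ B) {ξ : Env}
    {x : Site} : |r * ((1 - occ ξ x) * (u - v))| ≤ r * (2 * B) := by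
  have h : |u - v| ≤ 2 * B := by rw [abs_le] at *; constructor <;> linarith
  rw [← mul_assoc, abs_mul]
  exact mul_le_mul (abs_mul_vacancy_le hr ξ x) h (abs_nonneg _) hr

/-- Linear growth in `a` is the point. The edges contribute at most `5 * (2 * a + 5) * 2 * m * B`,
which is below `50 * (a + 1) * m * B`; this is the `50` in `growthRate`. -/
lemma DependsOnBox.abs_envGenerator_le (hf : DependsOnBox a f) (hp : IsRate p) (hq : IsRate q)
    (hattr : IsAttractive p) (hnn : IsNearestNeighbor q) {B : ℝ} (hB : ∀ ξ, |f ξ| ≤ B)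
    (ξ : Env) : |envGenerator p q f ξ| ≤ growthRate p q * (a + 1) * B := by
  have hB0 : 0 ≤ B := (abs_nonneg _).trans (hB ξ)
  set m := ∑ k ∈ Finset.Icc (-2 : ℤ) 2, p k with hm
  have hm0 : 0 ≤ m := Finset.sum_nonneg fun k _ => hp k
  rw [hf.envGenerator_eq hattr hnn]
  have h1 : |∑ e ∈ edges a, p (e.2 - e.1) * occ ξ e.1 * (1 - occ ξ e.2) *
        (f (exchange e.1 e.2 ξ) - f ξ)| ≤ (5 * (2 * a + 5)) * (m * (2 * B)) := by
    refine (Finset.abs_sum_le_sum_abs _ _).trans ((Finset.sum_le_card_nsmul _ _ (m * (2 * B))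
      fun e he => ?_).trans ?_)
    · have hpm : p (e.2 - e.1) * occ ξ e.1 ≤ m := by
        simp only [edges, Finset.mem_filter, abs_le] at he
        refine (mul_le_of_le_one_right (hp _) (occ_le_one _ _)).trans ?_
        exact Finset.single_le_sum (f := p) (fun k _ => hp k) (Finset.mem_Icc.2 he.2)
      rw [mul_assoc (p _ * _)]
      exact (abs_jump_le (mul_nonneg (hp _) (occ_nonneg _ _)) (hB _) (hB _)).trans
        (mul_le_mul_of_nonneg_right hpm (by positivity))
    · rw [nsmul_eq_mul]
      exact mul_le_mul_of_nonneg_right (card_edges_le a) (by positivity)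
  have h2 := abs_jump_le (hq 1) (hB (shift siteOne ξ)) (hB ξ) (ξ := ξ) (x := siteOne)
  have h3 := abs_jump_le (hq (-1)) (hB (shift siteNegOne ξ)) (hB ξ) (ξ := ξ) (x := siteNegOne)
  refine (abs_add_le _ _).trans ((add_le_add h1 ((abs_add_le _ _).trans
    (add_le_add h2 h3))).trans ?_)
  have e1 := hq 1
  have e2 := hq (-1)
  have : growthRate p q * (a + 1) * B - (5 * (2 * a + 5) * (m * (2 * B)) +
      (q 1 * (2 * B) + q (-1) * (2 * B))) =
      30 * a * m * B + 2 * (q 1 + q (-1)) * a * B + (a + 1) * B := by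
    unfold growthRate; rw [← hm]; ring
  have : 0 ≤ 30 * a * m * B + 2 * (q 1 + q (-1)) * a * B + (a + 1) * B := by positivity
  linarith

end

/-! ### Displacement and current -/

/-- The integer-valued functional `X` starts from `0` and jumps by `1` and `-1` at the bounded
rates `u` and `v`. -/
structure IsCounter (p q : ℤ → ℝ) (X : State → ℤ) (u v : State → ℝ) (c : ℝ) : Prop where
  start : ∀ η, X (η, 0, 0) = 0
  depends : ∀ ξ ξ' n d, X (ξ, n, d) = X (ξ', n, d)
  measurable_up : Measurable u
  measurable_down : Measurable v
  abs_up_le : ∀ s, |u s| ≤ c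
  abs_down_le : ∀ s, |v s| ≤ c
  generator_eq : ∀ φ : ℤ → ℝ, ∀ s, generator p q (fun s => φ (X s)) s =
    u s * (φ (X s + 1) - φ (X s)) + v s * (φ (X s - 1) - φ (X s))

/-- The truncation of `k` to `[-K, K]`. -/
def clamp (K : ℕ) (k : ℤ) : ℝ := ((max (-(K : ℤ)) (min k K) : ℤ) : ℝ)

lemma abs_clamp_le (K : ℕ) (k : ℤ) : |clamp K k| ≤ K := by
  unfold clamp
  rw [← Int.cast_abs]
  have : |max (-(K : ℤ)) (min k K)| ≤ K := by rw [abs_le]; omega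
  exact_mod_cast this

lemma abs_clamp_le_abs (K : ℕ) (k : ℤ) : |clamp K k| ≤ |(k : ℝ)| := by
  unfold clamp
  rw [← Int.cast_abs, ← Int.cast_abs]
  have : |max (-(K : ℤ)) (min k K)| ≤ |k| := by
    rcases abs_cases k with h | h <;> rw [abs_le] <;> omega
  exact_mod_cast this

lemma abs_clamp_sub_le (K : ℕ) {k l : ℤ} (h : |k - l| ≤ 1) : |clamp K k - clamp K l| ≤ 1 := by
  unfold clamp
  rw [← Int.cast_sub, ← Int.cast_abs]
  have : |max (-(K : ℤ)) (min k K) - max (-(K : ℤ)) (min l K)| ≤ 1 := by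
    rw [abs_le] at *; omega
  exact_mod_cast this

lemma clamp_eq {K : ℕ} {k : ℤ} (h : |k| ≤ K) : clamp K k = k := by
  unfold clamp
  rw [abs_le] at h
  congr 1
  omega

lemma eventually_clamp_eq (k : ℤ) : ∀ᶠ K : ℕ in atTop, clamp K k = k := by
  filter_upwards [eventually_ge_atTop k.natAbs] with K hK
  exact clamp_eq (by rw [Int.abs_eq_natAbs]; exact_mod_cast hK)

section
variable {p q : ℤ → ℝ} {X : State → ℤ} {u v : State → ℝ} {c : ℝ}

lemma IsCounter.measurable (h : IsCounter p q X u v c) : Measurable X := by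
  have : X = (fun y : ℤ × ℤ => X (fun _ => false, y)) ∘ Prod.snd :=
    funext fun ⟨ξ, n, d⟩ => h.depends _ _ n d
  rw [this]
  exact (measurable_of_countable _).comp measurable_snd

lemma IsCounter.isBoundedLocal (h : IsCounter p q X u v c) {φ : ℤ → ℝ} {C : ℝ}
    (hφ : ∀ k, |φ k| ≤ C) : IsBoundedLocal fun s => φ (X s) :=
  ⟨⟨C, fun _ => hφ _⟩, ∅, fun ξ ξ' _ n d => congrArg φ (h.depends ξ ξ' n d)⟩

lemma IsCounter.measurable_generator (h : IsCounter p q X u v c) (φ : ℤ → ℝ) :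
    Measurable (generator p q fun s => φ (X s)) := by
  have hφ : ∀ g : ℤ → ℝ, Measurable fun s => g (X s) := fun g =>
    (measurable_of_countable g).comp h.measurable
  rw [funext (h.generator_eq φ)]
  exact (h.measurable_up.mul (hφ fun k => φ (k + 1) - φ k)).add
    (h.measurable_down.mul (hφ fun k => φ (k - 1) - φ k))

lemma IsCounter.abs_generator_le (h : IsCounter p q X u v c) {φ : ℤ → ℝ}
    (hφ : ∀ k l : ℤ, |k - l| ≤ 1 → |φ k - φ l| ≤ 1) (s : State) :
    |generator p q (fun s => φ (X s)) s| ≤ 2 * c := by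
  have h1 := hφ (X s + 1) (X s) (by simp)
  have h2 := hφ (X s - 1) (X s) (by simp)
  have hc : 0 ≤ c := (abs_nonneg _).trans (h.abs_up_le s)
  rw [h.generator_eq]
  refine (abs_add_le _ _).trans ?_
  rw [abs_mul, abs_mul]
  have e1 := mul_le_mul (h.abs_up_le s) h1 (abs_nonneg _) hc
  have e2 := mul_le_mul (h.abs_down_le s) h2 (abs_nonneg _) hc
  linarith

variable {P : Kernel Env Path} (ν : ProbabilityMeasure Env)

lemma IsCounter.mean_comp (h : IsCounter p q X u v c) (hP : IsProcessLaw p q P) {φ : ℤ → ℝ}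
    {C : ℝ} (hC : ∀ k, |φ k| ≤ C) (hφ : ∀ k l : ℤ, |k - l| ≤ 1 → |φ k - φ l| ≤ 1)
    (h0 : φ 0 = 0) {t : ℝ} (ht : 0 ≤ t) :
    mean P ν (fun s => φ (X s)) t =
      ∫ r in (0 : ℝ)..t, mean P ν (generator p q fun s => φ (X s)) r := by
  rw [hP.dynkin ν (h.isBoundedLocal hC) (h.measurable_generator φ) (h.abs_generator_le hφ) ht,
    hP.mean_zero ν (h.isBoundedLocal hC).measurable (fun s => hC _)]
  simp [h.start, h0]

/-- Dynkin's formula needs bounded functions, so it is applied to `|clamp K X|`. This is 1-Lipschitz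
on unit steps, so its mean is at most `2 * c * t` uniformly in `K`, and Fatou's lemma removes the
truncation. -/
lemma IsCounter.integrable (h : IsCounter p q X u v c) (hP : IsProcessLaw p q P) (t : ℝ≥0) :
    Integrable (fun w : Path => (X (w.1 t) : ℝ)) (pathLaw P ν) := by
  have := hP.isMarkov
  have := isProbabilityMeasure_pathLaw (P := P) ν
  have hX : Measurable fun w : Path => X (w.1 t) := h.measurable.comp (measurable_eval t)
  have hφm : ∀ g : ℤ → ℝ, Measurable fun w : Path => g (X (w.1 t)) := fun g =>
    (measurable_of_countable g).comp hX
  refine ⟨(hφm fun k => (k : ℝ)).aestronglyMeasurable, ?_⟩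
  have hbd : ∀ K : ℕ, ∫⁻ w : Path, ‖clamp K (X (w.1 t))‖ₑ ∂(pathLaw P ν) ≤
      ENNReal.ofReal (2 * c * t) := by
    intro K
    have hlip : ∀ k l : ℤ, |k - l| ≤ 1 → |(|clamp K k|) - (|clamp K l|)| ≤ 1 := fun k l hkl =>
      (abs_abs_sub_abs_le_abs_sub _ _).trans (abs_clamp_sub_le K hkl)
    have hm := h.mean_comp ν hP (φ := fun k => |clamp K k|)
      (fun k => by rw [abs_abs]; exact abs_clamp_le K k) hlip
      (by simp [clamp]) t.coe_nonneg
    have hle : mean P ν (fun s => |clamp K (X s)|) t ≤ 2 * c * t := by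
      rw [hm]
      refine (le_abs_self _).trans ?_
      have := intervalIntegral.norm_integral_le_of_norm_le_const (a := 0) (b := (t : ℝ))
        (f := mean P ν (generator p q fun s => |clamp K (X s)|)) (C := 2 * c)
        fun r _ => abs_mean_le ν (h.abs_generator_le hlip) r
      simpa using this
    unfold mean at hle
    rw [Real.toNNReal_coe] at hle
    calc ∫⁻ w : Path, ‖clamp K (X (w.1 t))‖ₑ ∂(pathLaw P ν)
        = ∫⁻ w : Path, ENNReal.ofReal |clamp K (X (w.1 t))| ∂(pathLaw P ν) := by
          simp_rw [Real.enorm_eq_ofReal_abs]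
      _ = ENNReal.ofReal (∫ w : Path, |clamp K (X (w.1 t))| ∂(pathLaw P ν)) := by
          refine (ofReal_integral_eq_lintegral_ofReal ?_ (Eventually.of_forall fun w =>
            abs_nonneg _)).symm
          exact integrable_of_bounded (hφm fun k => |clamp K k|)
            fun w => by rw [abs_abs]; exact abs_clamp_le K _
      _ ≤ _ := ENNReal.ofReal_le_ofReal hle
  have hfatou : ∫⁻ w : Path, ‖(X (w.1 t) : ℝ)‖ₑ ∂(pathLaw P ν) ≤
      ENNReal.ofReal (2 * c * t) := by
    calc ∫⁻ w : Path, ‖(X (w.1 t) : ℝ)‖ₑ ∂(pathLaw P ν)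
        = ∫⁻ w : Path, liminf (fun K : ℕ => ‖clamp K (X (w.1 t))‖ₑ) atTop ∂(pathLaw P ν) := by
          refine lintegral_congr fun w => (Tendsto.liminf_eq ?_).symm
          refine tendsto_const_nhds.congr' ?_
          filter_upwards [eventually_clamp_eq (X (w.1 t))] with K hK
          rw [hK]
      _ ≤ liminf (fun K : ℕ => ∫⁻ w : Path, ‖clamp K (X (w.1 t))‖ₑ ∂(pathLaw P ν)) atTop :=
          lintegral_liminf_le fun K => (hφm (clamp K)).enorm
      _ ≤ _ := by
          refine liminf_le_of_frequently_le' (Eventually.of_forall hbd).frequently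
  exact hfatou.trans_lt ENNReal.ofReal_lt_top

/-- Let `K → ∞` in Dynkin's formula for `clamp K X`: the left side is dominated by `|X|`, the right
by `2 * c`, and at each state the generator equals `u - v` for all large `K`. -/
lemma IsCounter.mean_eq (h : IsCounter p q X u v c) (hP : IsProcessLaw p q P) {t : ℝ}
    (ht : 0 ≤ t) :
    mean P ν (fun s => (X s : ℝ)) t = ∫ r in (0 : ℝ)..t, mean P ν (fun s => u s - v s) r := by
  have := hP.isMarkov
  have := isProbabilityMeasure_pathLaw (P := P) ν
  have hlip : ∀ K : ℕ, ∀ k l : ℤ, |k - l| ≤ 1 → |clamp K k - clamp K l| ≤ 1 :=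
    fun K k l hkl => abs_clamp_sub_le K hkl
  have h1 : Tendsto (fun K : ℕ => mean P ν (fun s => clamp K (X s)) t) atTop
      (𝓝 (mean P ν (fun s => (X s : ℝ)) t)) := by
    refine tendsto_integral_of_dominated_convergence
      (fun w => |(X (w.1 t.toNNReal) : ℝ)|) (fun K => ?_) (h.integrable ν hP _).abs
      (fun K => Eventually.of_forall fun w => abs_clamp_le_abs K _)
      (Eventually.of_forall fun w => ?_)
    · exact ((measurable_of_countable (clamp K)).comp
        (h.measurable.comp (measurable_eval _))).aestronglyMeasurable
    · refine tendsto_const_nhds.congr' ?_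
      filter_upwards [eventually_clamp_eq (X (w.1 t.toNNReal))] with K hK
      rw [hK]
  have h2 : ∀ r, Tendsto (fun K : ℕ => mean P ν (generator p q fun s => clamp K (X s)) r) atTop
      (𝓝 (mean P ν (fun s => u s - v s) r)) := by
    intro r
    refine tendsto_integral_of_dominated_convergence (fun _ => 2 * c) (fun K => ?_)
      (integrable_const _)
      (fun K => Eventually.of_forall fun w => h.abs_generator_le (hlip K) _)
      (Eventually.of_forall fun w => ?_)
    · exact ((h.measurable_generator (clamp K)).comp (measurable_eval _)).aestronglyMeasurable
    · refine tendsto_const_nhds.congr' ?_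
      filter_upwards [eventually_clamp_eq (X (w.1 r.toNNReal)),
        eventually_clamp_eq (X (w.1 r.toNNReal) + 1),
        eventually_clamp_eq (X (w.1 r.toNNReal) - 1)] with K e1 e2 e3
      rw [h.generator_eq, e1, e2, e3]
      push_cast
      ring
  have h3 : Tendsto (fun K : ℕ => ∫ r in (0 : ℝ)..t,
      mean P ν (generator p q fun s => clamp K (X s)) r) atTop
      (𝓝 (∫ r in (0 : ℝ)..t, mean P ν (fun s => u s - v s) r)) := by
    refine intervalIntegral.tendsto_integral_filter_of_dominated_convergence (fun _ => 2 * c)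
      (Eventually.of_forall fun K => ?_) (Eventually.of_forall fun K => ?_)
      intervalIntegrable_const (Eventually.of_forall fun r _ => h2 r)
    · exact (intervalIntegrable_mean ν (h.measurable_generator (clamp K))
        (h.abs_generator_le (hlip K)) ht).aestronglyMeasurable_restrict_uIoc
    · exact Eventually.of_forall fun r _ => abs_mean_le ν (h.abs_generator_le (hlip K)) r
  refine tendsto_nhds_unique h1 (h3.congr fun K => ?_)
  exact (h.mean_comp ν hP (abs_clamp_le K) (hlip K) (by simp [clamp]) ht).symm

end

lemma measurable_occ (x : Site) : Measurable fun s : State => occ s.1 x := by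
  have : (fun s : State => occ s.1 x) = (fun b : Bool => if b = true then (1 : ℝ) else 0) ∘
      fun s : State => s.1 x := rfl
  rw [this]
  exact (measurable_of_countable _).comp ((measurable_pi_apply x).comp measurable_fst)

lemma isCounter_displacement {p q : ℤ → ℝ} (hq : IsRate q) (hnn : IsNearestNeighbor q) :
    IsCounter p q (fun s => s.2.2) (fun s => q 1 * (1 - occ s.1 siteOne))
      (fun s => q (-1) * (1 - occ s.1 siteNegOne)) (q 1 + q (-1)) where
  start _ := rfl
  depends _ _ _ _ := rfl
  measurable_up := ((measurable_occ _).const_sub 1).const_mul _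
  measurable_down := ((measurable_occ _).const_sub 1).const_mul _
  abs_up_le s := by linarith [abs_mul_vacancy_le (hq 1) s.1 siteOne, hq (-1)]
  abs_down_le s := by linarith [abs_mul_vacancy_le (hq (-1)) s.1 siteNegOne, hq 1]
  generator_eq φ s := by
    unfold generator
    simp only [sub_self, mul_zero, tsum_zero, zero_add]
    simp_rw [mul_assoc]
    exact tsum_site_eq hnn fun z => (1 - occ s.1 z) * (φ (s.2.2 + z) - φ s.2.2)

lemma isCounter_current {p q : ℤ → ℝ} (hp : IsRate p) (hattr : IsAttractive p) :
    IsCounter p q (fun s => s.2.1)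
      (fun s => p 2 * occ s.1 siteNegOne * (1 - occ s.1 siteOne))
      (fun s => p (-2) * occ s.1 siteOne * (1 - occ s.1 siteNegOne)) (p 2 + p (-2)) where
  start _ := rfl
  depends _ _ _ _ := rfl
  measurable_up := ((measurable_occ _).const_mul _).mul ((measurable_occ _).const_sub 1)
  measurable_down := ((measurable_occ _).const_mul _).mul ((measurable_occ _).const_sub 1)
  abs_up_le s := by
    linarith [abs_mul_vacancy_le (mul_nonneg (hp 2) (occ_nonneg s.1 siteNegOne)) s.1 siteOne,
      mul_le_of_le_one_right (hp 2) (occ_le_one s.1 siteNegOne), hp (-2)]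
  abs_down_le s := by
    linarith [abs_mul_vacancy_le (mul_nonneg (hp (-2)) (occ_nonneg s.1 siteOne)) s.1 siteNegOne,
      mul_le_of_le_one_right (hp (-2)) (occ_le_one s.1 siteOne), hp 2]
  generator_eq φ s := by
    unfold generator
    simp only [sub_self, mul_zero, tsum_zero, add_zero]
    have hne : (siteNegOne, siteOne) ≠ (siteOne, siteNegOne) := by
      intro h
      exact absurd (congrArg (fun e : Site × Site => (e.1 : ℤ)) h)
        (by norm_num [siteOne, siteNegOne])
    rw [tsum_eq_sum (s := {(siteNegOne, siteOne), (siteOne, siteNegOne)}), Finset.sum_pair hne]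
    · simp [crossing, siteOne, siteNegOne, sub_eq_add_neg]
    · rintro ⟨x, y⟩ he
      simp only [Finset.mem_insert, Finset.mem_singleton, not_or] at he
      by_cases h2 : 2 < |(y : ℤ) - x|
      · simp [hattr.2 _ h2]
      -- As `0` is not a site, a crossing of length at most `2` joins `-1` and `1`.
      · have hc : crossing x y = 0 := by
          have hx := x.2
          have hy := y.2
          rw [not_lt, abs_le] at h2
          have e1 : ¬ ((x : ℤ) = -1 ∧ (y : ℤ) = 1) := fun h =>
            he.1 (Prod.ext (Subtype.ext h.1) (Subtype.ext h.2))
          have e2 : ¬ ((x : ℤ) = 1 ∧ (y : ℤ) = -1) := fun h =>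
            he.2 (Prod.ext (Subtype.ext h.1) (Subtype.ext h.2))
          unfold crossing
          rw [if_neg (by omega), if_neg (by omega)]
        simp [hc]

/-! ### Invariance of infinitesimally invariant measures -/

lemma DependsOnBox.measurable_lift {a : ℕ} {f : Env → ℝ} (hf : DependsOnBox a f) :
    Measurable (lift f) :=
  (continuous_of_local (A := box a) fun ξ ξ' h _ _ => hf ξ ξ' h).measurable

lemma DependsOnBox.continuous {a : ℕ} {f : Env → ℝ} (hf : DependsOnBox a f) : Continuous f :=
  (continuous_of_local (F := lift f) (A := box a) fun ξ ξ' h _ _ => hf ξ ξ' h).comp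
    (Continuous.prodMk_left (0, 0))

/-- The product bounds the growth of the iterated generator; the `n!` here cancels the `1 / n!` from
iterated time integration. -/
lemma prod_add_two_mul_le (a n : ℕ) :
    (∏ i ∈ Finset.range n, ((a : ℝ) + 1 + 2 * i)) ≤ 4 ^ n * 2 ^ a * n.factorial := by
  have h1 : ∏ i ∈ Finset.range n, (a + 1 + 2 * i) ≤ 4 ^ n * 2 ^ a * n.factorial := by
    calc ∏ i ∈ Finset.range n, (a + 1 + 2 * i)
        ≤ ∏ i ∈ Finset.range n, 2 * (a + 1 + i) := by
          refine Finset.prod_le_prod' fun i _ => ?_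
          omega
      _ = 2 ^ n * (n.factorial * (a + n).choose n) := by
          rw [Finset.prod_mul_distrib, Finset.prod_const, Finset.card_range,
            ← Nat.ascFactorial_eq_prod_range, Nat.ascFactorial_eq_factorial_mul_choose]
      _ ≤ 2 ^ n * (n.factorial * 2 ^ (a + n)) := by
          gcongr
          exact Nat.choose_le_two_pow _ _
      _ = 4 ^ n * 2 ^ a * n.factorial := by
          rw [show (4 : ℕ) = 2 * 2 from rfl, mul_pow, pow_add]; ring
  exact_mod_cast h1

section
variable {p q : ℤ → ℝ} {P : Kernel Env Path} {ν : ProbabilityMeasure Env}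

/-- The law of `ξ_s` and `ν` agree on local functions. -/
def AgreesAt (P : Kernel Env Path) (ν : ProbabilityMeasure Env) (s : ℝ) : Prop :=
  ∀ (a : ℕ) (f : Env → ℝ) (B : ℝ), DependsOnBox a f → (∀ ξ, |f ξ| ≤ B) →
    mean P ν (lift f) s = ∫ ξ, f ξ ∂(ν : Measure Env)

/-- The generator has mean zero on local functions. -/
def IsInfinitesimallyInvariant (p q : ℤ → ℝ) (ν : ProbabilityMeasure Env) : Prop :=
  ∀ (a : ℕ) (f : Env → ℝ) (B : ℝ), DependsOnBox a f → (∀ ξ, |f ξ| ≤ B) →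
    ∫ ξ, envGenerator p q f ξ ∂(ν : Measure Env) = 0

variable (hp : IsRate p) (hq : IsRate q) (hattr : IsAttractive p) (hnn : IsNearestNeighbor q)
  (hP : IsProcessLaw p q P)
include hp hq hattr hnn hP

lemma mean_lift_dynkin (ν : ProbabilityMeasure Env) {a : ℕ} {f : Env → ℝ} {B : ℝ}
    (hf : DependsOnBox a f) (hB : ∀ ξ, |f ξ| ≤ B) {t : ℝ} (ht : 0 ≤ t) :
    mean P ν (lift f) t =
      mean P ν (lift f) 0 + ∫ r in (0 : ℝ)..t, mean P ν (lift (envGenerator p q f)) r :=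
  hP.dynkin ν (hf.isBoundedLocal hB) (hf.dependsOnBox_envGenerator hattr hnn).measurable_lift
    (fun s => hf.abs_envGenerator_le hp hq hattr hnn hB s.1) ht

/-- Restarting at `s` by subtracting two Dynkin formulas from time `0` avoids the Markov property.
-/
lemma mean_lift_sub (ν : ProbabilityMeasure Env) {a : ℕ} {f : Env → ℝ} {B : ℝ}
    (hf : DependsOnBox a f) (hB : ∀ ξ, |f ξ| ≤ B) {s t : ℝ} (hs : 0 ≤ s) (ht : 0 ≤ t) :
    mean P ν (lift f) (s + t) - mean P ν (lift f) s =
      ∫ r in (0 : ℝ)..t, mean P ν (lift (envGenerator p q f)) (s + r) := by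
  have := hP.isMarkov
  have hint : ∀ b c : ℝ, b ≤ c →
      IntervalIntegrable (mean P ν (lift (envGenerator p q f))) volume b c := fun b c hbc =>
    intervalIntegrable_mean ν (hf.dependsOnBox_envGenerator hattr hnn).measurable_lift
      (fun s => hf.abs_envGenerator_le hp hq hattr hnn hB s.1) hbc
  rw [mean_lift_dynkin hp hq hattr hnn hP ν hf hB (add_nonneg hs ht),
    mean_lift_dynkin hp hq hattr hnn hP ν hf hB hs, intervalIntegral.integral_comp_add_left,
    ← intervalIntegral.integral_add_adjacent_intervals (hint 0 s hs) (hint s (s + t) (by linarith))]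
  simp

/-- Induction on `n` with `f` and its box free: the step applies the bound for `n` to `envGenerator
p q f`, which lives on `box (a + 2)` and has `ν`-mean zero, and integrates over time. -/
lemma abs_mean_sub_le (hν : IsInfinitesimallyInvariant p q ν) {s : ℝ} (hs : 0 ≤ s)
    (hag : AgreesAt P ν s) (n : ℕ) : ∀ {a : ℕ} {f : Env → ℝ} {B : ℝ},
    DependsOnBox a f → (∀ ξ, |f ξ| ≤ B) → ∀ {t : ℝ}, 0 ≤ t →
      |mean P ν (lift f) (s + t) - ∫ ξ, f ξ ∂(ν : Measure Env)| ≤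
        (growthRate p q * t) ^ n / n.factorial *
          (∏ i ∈ Finset.range n, ((a : ℝ) + 1 + 2 * i)) * (2 * B) := by
  have := hP.isMarkov
  induction n with
  | zero =>
    intro a f B hf hB t ht
    have h1 := abs_mean_le (P := P) ν (G := lift f) (fun s => hB s.1) (s + t)
    have h2 : |∫ ξ, f ξ ∂(ν : Measure Env)| ≤ B := by
      simpa using norm_integral_le_of_norm_le_const (μ := (ν : Measure Env))
        (f := f) (Eventually.of_forall hB)
    simp only [pow_zero, Nat.factorial_zero, Nat.cast_one, div_one, Finset.range_zero,
      Finset.prod_empty, mul_one, one_mul]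
    rw [abs_le] at *
    constructor <;> linarith
  | succ n ih =>
    intro a f B hf hB t ht
    set K := growthRate p q with hK
    have hg := hf.dependsOnBox_envGenerator hattr hnn
    have hgB := hf.abs_envGenerator_le hp hq hattr hnn hB
    rw [← hag a f B hf hB, mean_lift_sub hp hq hattr hnn hP ν hf hB hs ht]
    set A : ℝ := K ^ n / n.factorial * (∏ i ∈ Finset.range n, (((a + 2 : ℕ) : ℝ) + 1 + 2 * i)) *
      (2 * (K * (a + 1) * B)) with hA
    have hbound : ∀ r ∈ Set.Ioc 0 t,
        ‖mean P ν (lift (envGenerator p q f)) (s + r)‖ ≤ A * r ^ n := by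
      intro r hr
      have h := ih hg hgB hr.1.le
      rw [hν a f B hf hB, sub_zero, mul_pow] at h
      rw [Real.norm_eq_abs]
      refine h.trans (le_of_eq ?_)
      rw [hA]; ring
    have hint : IntervalIntegrable (fun r => A * r ^ n) volume 0 t :=
      (continuous_const.mul (continuous_pow n)).intervalIntegrable _ _
    have h := intervalIntegral.norm_integral_le_of_norm_le ht (Eventually.of_forall hbound) hint
    rw [Real.norm_eq_abs] at h
    refine h.trans (le_of_eq ?_)
    rw [intervalIntegral.integral_const_mul, integral_pow, Finset.prod_range_succ',
      Nat.factorial_succ, hA]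
    have hprod : ∏ i ∈ Finset.range n, (((a + 2 : ℕ) : ℝ) + 1 + 2 * i) =
        ∏ i ∈ Finset.range n, ((a : ℝ) + 1 + 2 * ((i + 1 : ℕ) : ℝ)) :=
      Finset.prod_congr rfl fun i _ => by push_cast; ring
    rw [hprod]
    have hn : (n.factorial : ℝ) ≠ 0 := by positivity
    have hn1 : (n : ℝ) + 1 ≠ 0 := by positivity
    push_cast
    field_simp
    ring

/-- The `8` makes the `n`-th bound geometric: `(1 / 8) ^ n * 4 ^ n = (1 / 2) ^ n`. The admissible
time step depends neither on `f` nor on its box, so steps can be concatenated. -/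
lemma AgreesAt.add (hν : IsInfinitesimallyInvariant p q ν) {s : ℝ} (hs : 0 ≤ s)
    (hag : AgreesAt P ν s) {t : ℝ} (ht : 0 ≤ t) (ht' : t ≤ 1 / (8 * growthRate p q)) :
    AgreesAt P ν (s + t) := by
  intro a f B hf hB
  have hK := growthRate_pos hp hq
  have hB0 : 0 ≤ B := (abs_nonneg _).trans (hB fun _ => false)
  have hKt : growthRate p q * t ≤ 1 / 8 := by
    rw [le_div_iff₀ (by positivity)] at ht'
    linarith
  have hle : ∀ n : ℕ, |mean P ν (lift f) (s + t) - ∫ ξ, f ξ ∂(ν : Measure Env)| ≤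
      (1 / 2) ^ n * (2 ^ a * (2 * B)) := by
    intro n
    refine (abs_mean_sub_le hp hq hattr hnn hP hν hs hag n hf hB ht).trans ?_
    calc (growthRate p q * t) ^ n / n.factorial *
          (∏ i ∈ Finset.range n, ((a : ℝ) + 1 + 2 * i)) * (2 * B)
        ≤ (1 / 8) ^ n / n.factorial * (4 ^ n * 2 ^ a * n.factorial) * (2 * B) := by
          gcongr
          exact prod_add_two_mul_le a n
      _ = ((1 / 8) ^ n * 4 ^ n) * (2 ^ a * (2 * B)) := by
          have hn : (n.factorial : ℝ) ≠ 0 := by positivity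
          field_simp
      _ = (1 / 2) ^ n * (2 ^ a * (2 * B)) := by
          rw [← mul_pow]; norm_num
  have hlim : Tendsto (fun n : ℕ => (1 / 2 : ℝ) ^ n * (2 ^ a * (2 * B))) atTop (𝓝 0) := by
    simpa using (tendsto_pow_atTop_nhds_zero_of_lt_one (r := (1 / 2 : ℝ)) (by norm_num)
      (by norm_num)).mul_const (2 ^ a * (2 * B))
  have h0 := ge_of_tendsto' hlim hle
  exact sub_eq_zero.1 (abs_eq_zero.1 (le_antisymm h0 (abs_nonneg _)))

lemma IsInfinitesimallyInvariant.agreesAt (hν : IsInfinitesimallyInvariant p q ν) {t : ℝ}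
    (ht : 0 ≤ t) : AgreesAt P ν t := by
  have hK := growthRate_pos hp hq
  set δ := 1 / (8 * growthRate p q) with hδ
  have hδ0 : 0 < δ := by positivity
  have key : ∀ n : ℕ, ∀ t : ℝ, 0 ≤ t → t ≤ n * δ → AgreesAt P ν t := by
    intro n
    induction n with
    | zero =>
      intro t h0 h1
      have : t = 0 := le_antisymm (by simpa using h1) h0
      subst this
      intro a f B hf hB
      exact hP.mean_zero ν hf.measurable_lift fun s => hB s.1
    | succ n ih =>
      intro t h0 h1
      push_cast at h1
      by_cases h : t ≤ n * δ
      · exact ih t h0 h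
      · have h2 : t = n * δ + (t - n * δ) := by ring
        rw [h2]
        exact AgreesAt.add hp hq hattr hnn hP hν (by positivity) (ih _ (by positivity) le_rfl)
          (by linarith) (by linarith)
  obtain ⟨n, hn⟩ := exists_nat_ge (t / δ)
  exact key n t ht (by rwa [div_le_iff₀ hδ0] at hn)

lemma IsInfinitesimallyInvariant.isInvariant (hν : IsInfinitesimallyInvariant p q ν) :
    IsInvariant P ν := by
  intro t
  have := hP.isMarkov
  have := isProbabilityMeasure_pathLaw (P := P) ν
  have henv : Measurable (env t) := measurable_fst.comp (measurable_eval t)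
  have : IsProbabilityMeasure ((pathLaw P ν).map (env t)) :=
    Measure.isProbabilityMeasure_map henv.aemeasurable
  -- Indicators of cylinders are local, and cylinders form a generating π-system.
  refine ext_of_generate_finite (measurableCylinders fun _ : Site => Bool)
    generateFrom_measurableCylinders.symm isPiSystem_measurableCylinders ?_ (by simp)
  intro C hC
  obtain ⟨S, A, hA, rfl⟩ := (mem_measurableCylinders C).1 hC
  set C := cylinder (α := fun _ : Site => Bool) S A with hCdef
  have hCm : MeasurableSet C := hA.cylinder S
  set f : Env → ℝ := C.indicator 1 with hf
  have hdep : DependsOnBox (S.sup fun x => (x : ℤ).natAbs) f := by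
    intro ξ ξ' h
    have hmem : ξ ∈ C ↔ ξ' ∈ C := by
      rw [hCdef, mem_cylinder, mem_cylinder]
      have : S.restrict ξ = S.restrict ξ' := by
        funext x
        refine h x (mem_box.2 ?_)
        have := Finset.le_sup (f := fun x : Site => (x : ℤ).natAbs) x.2
        omega
      rw [this]
    by_cases hξ : ξ ∈ C
    · simp [hf, hξ, hmem.1 hξ]
    · have hξ' : ξ' ∉ C := fun h' => hξ (hmem.2 h')
      simp [hf, hξ, hξ']
  have h := hν.agreesAt hp hq hattr hnn hP t.coe_nonneg _ f 1 hdep (fun ξ => by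
    by_cases hξ : ξ ∈ C <;> simp [hf, hξ])
  have h1 : mean P ν (lift f) t = ((pathLaw P ν).map (env t)).real C := by
    rw [← integral_indicator_one hCm, integral_map henv.aemeasurable
      (hdep.continuous.measurable.aestronglyMeasurable)]
    unfold mean lift env
    rw [Real.toNNReal_coe]
  rw [h1, integral_indicator_one hCm, measureReal_eq_measureReal_iff] at h
  exact h

end

/-! ### Time averages -/

section
variable {p q : ℤ → ℝ} {P : Kernel Env Path}

lemma timeAverage_eq [IsMarkovKernel P] (ν : ProbabilityMeasure Env) {f : Env → ℝ}
    (hf : Measurable f) {C : ℝ} (hC : ∀ ξ, |f ξ| ≤ C) {t : ℝ} (ht : 0 ≤ t) :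
    timeAverage P ν t f = t⁻¹ * ∫ s in (0 : ℝ)..t, mean P ν (lift f) s := by
  rw [← integral_pathLaw_intervalIntegral (G := lift f) ν (hf.comp measurable_fst)
    (fun s => hC s.1) ht]
  rfl

lemma exists_forall_abs_le (f : C(Env, ℝ)) : ∃ C, ∀ ξ, |f ξ| ≤ C := by
  obtain ⟨C, hC⟩ := isCompact_univ.exists_bound_of_continuousOn f.continuous.continuousOn
  exact ⟨C, fun ξ => hC ξ trivial⟩

/-- The time averages are the integrals with respect to a probability measure. -/
lemma exists_probabilityMeasure_timeAverage [IsMarkovKernel P] (ν : ProbabilityMeasure Env)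
    {t : ℝ} (ht : 0 < t) :
    ∃ μ : ProbabilityMeasure Env, ∀ f : C(Env, ℝ),
      timeAverage P ν t f = ∫ ξ, f ξ ∂(μ : Measure Env) := by
  have := isProbabilityMeasure_pathLaw (P := P) ν
  have hvol : (volume (Set.Ioc 0 t)) = ENNReal.ofReal t := by simp
  have : IsProbabilityMeasure (cond (volume : Measure ℝ) (Set.Ioc 0 t)) :=
    cond_isProbabilityMeasure_of_finite (by rw [hvol]; simpa using ht) (by rw [hvol]; simp)
  -- The measure is the law of `ξ_U`, with `U` uniform on `(0, t]` and independent of the path.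
  let M := (cond (volume : Measure ℝ) (Set.Ioc 0 t)).prod (pathLaw P ν)
  let Φ : ℝ × Path → Env := fun x => env x.1.toNNReal x.2
  have hΦ : Measurable Φ := measurable_fst.comp (measurable_eval_uncurry.comp
    ((measurable_real_toNNReal.comp measurable_fst).prodMk measurable_snd))
  refine ⟨⟨M.map Φ, Measure.isProbabilityMeasure_map hΦ.aemeasurable⟩, fun f => ?_⟩
  obtain ⟨C, hC⟩ := exists_forall_abs_le f
  rw [timeAverage_eq ν f.continuous.measurable hC ht.le]
  simp only [ProbabilityMeasure.coe_mk]
  have hint : Integrable (fun x => f (Φ x)) M :=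
    integrable_of_bounded (f.continuous.measurable.comp hΦ) fun x => hC _
  rw [integral_map hΦ.aemeasurable f.continuous.measurable.aestronglyMeasurable,
    integral_prod _ hint, ProbabilityTheory.cond, integral_smul_measure, hvol, intervalIntegral.integral_of_le ht.le, smul_eq_mul,
    ENNReal.toReal_inv, ENNReal.toReal_ofReal ht.le]
  rfl

/-- The time `t = 0` is included: both sides are then `0`, because `0⁻¹ = 0`. -/
lemma IsCounter.integral_div_eq {X : State → ℤ} {u v : State → ℝ} {c : ℝ}
    (h : IsCounter p q X u v c) (hP : IsProcessLaw p q P) (ν : ProbabilityMeasure Env)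
    {g : Env → ℝ} (hg : ∀ s, u s - v s = g s.1) (hgm : Measurable g) {C : ℝ}
    (hC : ∀ ξ, |g ξ| ≤ C) (t : ℝ≥0) :
    ∫ w, (X (w.1 t) : ℝ) / t ∂(pathLaw P ν) = timeAverage P ν t g := by
  have := hP.isMarkov
  have h1 := h.mean_eq ν hP t.coe_nonneg
  rw [funext hg] at h1
  rw [timeAverage_eq ν hgm hC t.coe_nonneg, integral_div, div_eq_inv_mul]
  unfold mean at h1 ⊢
  rw [Real.toNNReal_coe] at h1
  rw [h1]
  rfl

/-- Weak limits of time averages along times that tend to infinity are invariant. -/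
lemma isInfinitesimallyInvariant_of_tendsto (hp : IsRate p) (hq : IsRate q)
    (hattr : IsAttractive p) (hnn : IsNearestNeighbor q) (hP : IsProcessLaw p q P)
    (ν₀ : ProbabilityMeasure Env) {T : ℕ → ℝ} (hT0 : ∀ n, 0 < T n) (hT : Tendsto T atTop atTop)
    {ν : ProbabilityMeasure Env}
    (hν : ∀ f : C(Env, ℝ), Tendsto (fun n => timeAverage P ν₀ (T n) f) atTop
      (𝓝 (∫ ξ, f ξ ∂(ν : Measure Env)))) : IsInfinitesimallyInvariant p q ν := by
  have := hP.isMarkov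
  intro a f B hf hB
  have hg := hf.dependsOnBox_envGenerator hattr hnn
  have hgB := hf.abs_envGenerator_le hp hq hattr hnn hB
  refine tendsto_nhds_unique (hν ⟨_, hg.continuous⟩) ?_
  have hlim : Tendsto (fun n => (T n)⁻¹ * (2 * B)) atTop (𝓝 0) := by
    simpa using (tendsto_inv_atTop_zero.comp hT).mul_const (2 * B)
  refine squeeze_zero_norm (fun n => ?_) hlim
  have h := mean_lift_dynkin hp hq hattr hnn hP ν₀ hf hB (hT0 n).le
  have h1 := abs_mean_le (P := P) ν₀ (G := lift f) (fun s => hB s.1) (T n)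
  have h2 := abs_mean_le (P := P) ν₀ (G := lift f) (fun s => hB s.1) 0
  rw [ContinuousMap.coe_mk, timeAverage_eq ν₀ hg.continuous.measurable hgB (hT0 n).le, norm_mul,
    Real.norm_eq_abs, abs_of_pos (inv_pos.2 (hT0 n))]
  refine mul_le_mul_of_nonneg_left ?_ (inv_pos.2 (hT0 n)).le
  -- The time integral of the mean of `L f` is a difference of two means of `f`, hence at most `2 *
  -- B`.
  rw [Real.norm_eq_abs, abs_le]
  rw [abs_le] at h1 h2
  constructor <;> linarith

/-- The lower limit of time averages is attained along a sequence of times along which the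
time-average measures converge. -/
lemma exists_seq_tendsto_timeAverage [IsMarkovKernel P] (ν₀ : ProbabilityMeasure Env)
    (g : C(Env, ℝ)) :
    ∃ (T : ℕ → ℝ≥0) (ν : ProbabilityMeasure Env), (∀ n, 0 < T n) ∧ StrictMono T ∧
      Tendsto T atTop atTop ∧
      (∀ f : C(Env, ℝ), Tendsto (fun n => timeAverage P ν₀ (T n) f) atTop
        (𝓝 (∫ ξ, f ξ ∂(ν : Measure Env)))) ∧
      liminf (fun t : ℝ≥0 => (timeAverage P ν₀ t g : EReal)) atTop =
        ((∫ ξ, g ξ ∂(ν : Measure Env) : ℝ) : EReal) := by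
  obtain ⟨x, hx, hxt⟩ := exists_seq_tendsto_liminf (f := (atTop : Filter ℝ≥0))
    (u := fun t : ℝ≥0 => (timeAverage P ν₀ t g : EReal))
  obtain ⟨φ, hφ, hxφ⟩ := strictMono_subseq_of_tendsto_atTop hxt
  -- The first term may be time `0`; the index shift discards it.
  have hpos : ∀ n, 0 < x (φ (n + 1)) := fun n =>
    (zero_le (a := x (φ 0))).trans_lt (hxφ (Nat.succ_pos n))
  choose μ hμ using fun n =>
    exists_probabilityMeasure_timeAverage (P := P) ν₀ (NNReal.coe_pos.2 (hpos n))
  obtain ⟨ν, ψ, hψ, hν⟩ := CompactSpace.tendsto_subseq μ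
  have hsucc : StrictMono fun n : ℕ => n + 1 := fun _ _ h => Nat.succ_lt_succ h
  have hmono : StrictMono fun n => φ (ψ n + 1) := hφ.comp (hsucc.comp hψ)
  have hconv : ∀ f : C(Env, ℝ), Tendsto (fun n => timeAverage P ν₀ (x (φ (ψ n + 1))) f) atTop
      (𝓝 (∫ ξ, f ξ ∂(ν : Measure Env))) := by
    intro f
    have h := ProbabilityMeasure.tendsto_iff_forall_integral_tendsto.1 hν
      (BoundedContinuousFunction.mkOfCompact f)
    refine h.congr fun n => ?_
    exact (hμ (ψ n) f).symm
  refine ⟨fun n => x (φ (ψ n + 1)), ν, fun n => hpos _, hxφ.comp (hsucc.comp hψ),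
    hxt.comp hmono.tendsto_atTop, hconv, ?_⟩
  exact tendsto_nhds_unique (hx.comp hmono.tendsto_atTop)
    ((continuous_coe_real_ereal.tendsto _).comp (hconv g))

end

/-! ### Drift and current of the environment -/

lemma continuous_occ (x : Site) : Continuous fun ξ : Env => occ ξ x :=
  (continuous_of_discreteTopology (f := fun b : Bool => if b = true then (1 : ℝ) else 0)).comp
    (continuous_apply x)

lemma integrable_occ (ν : ProbabilityMeasure Env) (x : Site) :
    Integrable (fun ξ => occ ξ x) (ν : Measure Env) :=
  integrable_of_bounded (continuous_occ x).measurable fun ξ => by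
    rw [abs_of_nonneg (occ_nonneg ξ x)]; exact occ_le_one ξ x

/-- The drift of the tagged particle. -/
noncomputable def drift (q : ℤ → ℝ) : C(Env, ℝ) where
  toFun ξ := q 1 * (1 - occ ξ siteOne) - q (-1) * (1 - occ ξ siteNegOne)
  continuous_toFun := ((continuous_const.sub (continuous_occ _)).const_mul _).sub
    ((continuous_const.sub (continuous_occ _)).const_mul _)

/-- The mean rate of the passages to the right of the tagged particle. -/
noncomputable def passageRate (p : ℤ → ℝ) : C(Env, ℝ) where
  toFun ξ := p 2 * (occ ξ siteNegOne - occ ξ siteOne)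
  continuous_toFun := ((continuous_occ _).sub (continuous_occ _)).const_mul _

lemma integral_drift (q : ℤ → ℝ) (ν : ProbabilityMeasure Env) :
    ∫ ξ, drift q ξ ∂(ν : Measure Env) =
      q 1 * (∫ ξ, (1 - occ ξ siteOne) ∂(ν : Measure Env)) -
        q (-1) * (∫ ξ, (1 - occ ξ siteNegOne) ∂(ν : Measure Env)) := by
  have h : ∀ x, Integrable (fun ξ => 1 - occ ξ x) (ν : Measure Env) := fun x =>
    (integrable_const 1).sub (integrable_occ ν x)
  simp only [drift, ContinuousMap.coe_mk]
  rw [integral_sub ((h _).const_mul _) ((h _).const_mul _), integral_const_mul,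
    integral_const_mul]

lemma integral_passageRate (p : ℤ → ℝ) (ν : ProbabilityMeasure Env) :
    ∫ ξ, passageRate p ξ ∂(ν : Measure Env) =
      p 2 * (∫ ξ, (1 - occ ξ siteOne) ∂(ν : Measure Env) -
        ∫ ξ, (1 - occ ξ siteNegOne) ∂(ν : Measure Env)) := by
  simp only [passageRate, ContinuousMap.coe_mk]
  rw [integral_const_mul, integral_sub (integrable_occ ν _) (integrable_occ ν _),
    integral_sub (integrable_const 1) (integrable_occ ν _),
    integral_sub (integrable_const 1) (integrable_occ ν _)]
  ring

section
variable {p q : ℤ → ℝ} {P : Kernel Env Path} (hP : IsProcessLaw p q P)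
  (ν₀ : ProbabilityMeasure Env)
include hP

lemma liminfMean_displacement (hq : IsRate q) (hnn : IsNearestNeighbor q) :
    liminfMean P ν₀ displacement =
      liminf (fun t : ℝ≥0 => (timeAverage P ν₀ t (drift q) : EReal)) atTop := by
  obtain ⟨C, hC⟩ := exists_forall_abs_le (drift q)
  unfold liminfMean
  congr 1
  funext t
  exact congrArg _ ((isCounter_displacement hq hnn).integral_div_eq hP ν₀ (fun _ => rfl)
    (drift q).continuous.measurable hC t)

lemma liminfMean_current (hp : IsRate p) (hpos : IsPositive p) (hattr : IsAttractive p) :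
    liminfMean P ν₀ current =
      liminf (fun t : ℝ≥0 => (timeAverage P ν₀ t (passageRate p) : EReal)) atTop := by
  obtain ⟨C, hC⟩ := exists_forall_abs_le (passageRate p)
  unfold liminfMean
  congr 1
  funext t
  refine congrArg _ ((isCounter_current hp hattr).integral_div_eq hP ν₀ (fun s => ?_)
    (passageRate p).continuous.measurable hC t)
  -- With `p (-2) = p 2` the products of occupation numbers cancel, leaving a linear function.
  simp only [passageRate, ContinuousMap.coe_mk, ← hpos.1]
  ring

end

end TaggedExclusion

/-! ### The lower limit of the speed and its bound by the current -/

open TaggedExclusion in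
theorem mainTheorem7 (p q : ℤ → ℝ)
    (hp : TaggedExclusion.IsRate p) (hq : TaggedExclusion.IsRate q)
    (hpos : TaggedExclusion.IsPositive p) (hattr : TaggedExclusion.IsAttractive p)
    (hnn : TaggedExclusion.IsNearestNeighbor q)
    (P : Kernel TaggedExclusion.Env TaggedExclusion.Path)
    (hP : TaggedExclusion.IsProcessLaw p q P)
    (ν₀ : ProbabilityMeasure TaggedExclusion.Env) :
    (∀ t : ℝ≥0,
      Integrable (TaggedExclusion.displacement t) (TaggedExclusion.pathLaw P ν₀) ∧
      Integrable (TaggedExclusion.current t) (TaggedExclusion.pathLaw P ν₀)) ∧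
    (∃ (T : ℕ → ℝ) (ν : ProbabilityMeasure TaggedExclusion.Env),
      (∀ n, 0 < T n) ∧ StrictMono T ∧ Tendsto T atTop atTop ∧
      (∀ f : C(TaggedExclusion.Env, ℝ),
        Tendsto (fun n => TaggedExclusion.timeAverage P ν₀ (T n) f) atTop
          (𝓝 (∫ ξ, f ξ ∂(ν : Measure TaggedExclusion.Env)))) ∧
      TaggedExclusion.IsInvariant P ν ∧
      TaggedExclusion.liminfMean P ν₀ TaggedExclusion.displacement =
        ((q 1 * (∫ ξ, (1 - TaggedExclusion.occ ξ TaggedExclusion.siteOne)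
              ∂(ν : Measure TaggedExclusion.Env)) -
          q (-1) * (∫ ξ, (1 - TaggedExclusion.occ ξ TaggedExclusion.siteNegOne)
              ∂(ν : Measure TaggedExclusion.Env)) : ℝ) : EReal)) ∧
    (∀ C₀ : ℝ, 0 < C₀ →
      (C₀ : EReal) ≤ TaggedExclusion.liminfMean P ν₀ TaggedExclusion.current →
      ((q 1 / p 2 * C₀ - max (q (-1) - q 1) 0 : ℝ) : EReal) ≤
        TaggedExclusion.liminfMean P ν₀ TaggedExclusion.displacement) := by
  have := hP.isMarkov
  obtain ⟨T, ν, hT0, hTm, hT, hconv, hlim⟩ := exists_seq_tendsto_timeAverage (P := P) ν₀ (drift q)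
  have hT' : Tendsto (fun n => (T n : ℝ)) atTop atTop := NNReal.tendsto_coe_atTop.2 hT
  have hdisp := (liminfMean_displacement hP ν₀ hq hnn).trans hlim
  rw [integral_drift] at hdisp
  refine ⟨fun t => ⟨(isCounter_displacement hq hnn).integrable ν₀ hP t,
    (isCounter_current hp hattr).integrable ν₀ hP t⟩,
    ⟨fun n => T n, ν, hT0, fun _ _ h => hTm h, hT', hconv, ?_, hdisp⟩, fun C₀ _ hC => ?_⟩
  · exact (isInfinitesimallyInvariant_of_tendsto hp hq hattr hnn hP ν₀
      (fun n => NNReal.coe_pos.2 (hT0 n)) hT' hconv).isInvariant hp hq hattr hnn hP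
  · rw [hdisp, EReal.coe_le_coe_iff]
    rw [liminfMean_current hP ν₀ hp hpos hattr] at hC
    -- The lower limit over all times is at most the limit along `T`, although `T` was chosen for
    -- the displacement.
    have hle : C₀ ≤ ∫ ξ, passageRate p ξ ∂(ν : Measure Env) := by
      rw [← EReal.coe_le_coe_iff]
      refine (hC.trans hT.liminf_le_liminf_comp).trans (le_of_eq ?_)
      exact ((continuous_coe_real_ereal.tendsto _).comp (hconv (passageRate p))).liminf_eq
    rw [integral_passageRate] at hle
    have hp2 : 0 < p 2 := hpos.1 ▸ hpos.2.1
    have hv0 : 0 ≤ ∫ ξ, (1 - occ ξ siteNegOne) ∂(ν : Measure Env) :=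
      integral_nonneg fun ξ => sub_nonneg.2 (occ_le_one _ _)
    have hv1 : ∫ ξ, (1 - occ ξ siteNegOne) ∂(ν : Measure Env) ≤ 1 := by
      rw [integral_sub (integrable_const 1) (integrable_occ ν _)]
      have h : 0 ≤ ∫ ξ, occ ξ siteNegOne ∂(ν : Measure Env) :=
        integral_nonneg fun ξ => occ_nonneg ξ siteNegOne
      simpa using h
    set v₁ := ∫ ξ, (1 - occ ξ siteOne) ∂(ν : Measure Env)
    set v₂ := ∫ ξ, (1 - occ ξ siteNegOne) ∂(ν : Measure Env)
    have h1 : q 1 / p 2 * C₀ ≤ q 1 * (v₁ - v₂) := by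
      calc q 1 / p 2 * C₀ ≤ q 1 / p 2 * (p 2 * (v₁ - v₂)) :=
            mul_le_mul_of_nonneg_left hle (div_nonneg (hq 1) hp2.le)
        _ = q 1 * (v₁ - v₂) := by field_simp
    have h2 : (q (-1) - q 1) * v₂ ≤ max (q (-1) - q 1) 0 :=
      (mul_le_mul_of_nonneg_right (le_max_left _ 0) hv0).trans
        (mul_le_of_le_one_right (le_max_right _ _) hv1)
    linarith
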